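/- Let $n\ge 1$, let $\Omega\subset\mathbb R^n$ be an open set with finite Lebesgue measure $|\Omega|<\infty$, and let $p:\Omega\to[1,\infty]$ be measurable with $p_+=\operatorname{ess\,sup}_{\Omega}p<\infty$. Let $\alpha>0$. For measurable $f:\Omega\to\mathbb R$ and $\mu>0$ put $$\rho_\mu(f)=\int_{\{p<\infty\}}\Big(\frac{|f(x)|}{\mu}\Big)^{p(x)}dx+\mu^{-1}\|f\|_{L^\infty(\{p=\infty\})},\qquad \sigma_\mu(f)=\int_\Omega M\Big(\frac{|f(x)|}{\mu}\Big)dx,\quad M(t)=t\,(\ln(e+t))^\alpha .$$ The space $L^{p(\cdot)}(\Omega)$ (respectively $L(\log L)^\alpha(\Omega)$) consists of the measurable $f$ with $\rho_\mu(f)<\infty$ (respectively $\sigma_\mu(f)<\infty$) for some $\mu>0$, and its norm is $\inf\{\mu>0:\rho_\mu(f)\le1\}$ (respectively $\inf\{\mu>0:\sigma_\mu(f)\le1\}$). (a) Suppose there is a constant $C>1$ such that, for all sufficiently small $\lambda>0$, $$|\{x\in\Omega: p(x)\le 1+\lambda\}|\le C^{1/\lambda}\,\lambda^{\alpha/\lambda}\,(\ln(1/\lambda))^{-\alpha/\lambda}.$$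 Then $L^{p(\cdot)}(\Omega)\subset L(\log L)^\alpha(\Omega)$, and the embedding is continuous: there is a constant $K$ with $\|f\|_{L(\log L)^\alpha(\Omega)}\le K\|f\|_{L^{p(\cdot)}(\Omega)}$ for all $f\in L^{p(\cdot)}(\Omega)$. (b) Let $\theta:[0,\infty)\to[0,\infty)$ be a nondecreasing differentiable function with $\theta(t)\to\infty$ as $t\to\infty$ such that the function $\lambda\mapsto\theta(1/\lambda)(1/\lambda)^{-\alpha}(\ln(1/\lambda))^{-\alpha}$ is nondecreasing for all sufficiently small $\lambda>0$. If $$\liminf_{\lambda\to0^+}\,|\{x\in\Omega: p(x)\le 1+\lambda\}|\;\theta(1/\lambda)^{-1/\lambda}\,\lambda^{-\alpha/\lambda}\,(\ln(1/\lambda))^{\alpha/\lambda}>0$$ (the value $+\infty$ being allowed), then $L^{p(\cdot)}(\Omega)\not\subset L(\log L)^\alpha(\Omega)$. -/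

import Mathlib

open MeasureTheory Filter Set
open scoped Topology ENNReal NNReal

noncomputable section

/-- Exponent functions on `Ω`: Lebesgue measurable functions with values in `[1, ∞]` on `Ω`
(values outside `Ω` play no role). -/
structure IsExponent {n : ℕ} (Ω : Set (EuclideanSpace ℝ (Fin n)))
    (p : EuclideanSpace ℝ (Fin n) → ℝ≥0∞) : Prop where
  aemeasurable : AEMeasurable p (volume.restrict Ω)
  one_le : ∀ x ∈ Ω, 1 ≤ p x

/-- `p₊`, the essential supremum of `p` over `Ω`. -/
def exponentSup {n : ℕ} (Ω : Set (EuclideanSpace ℝ (Fin n)))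
    (p : EuclideanSpace ℝ (Fin n) → ℝ≥0∞) : ℝ≥0∞ :=
  essSup p (volume.restrict Ω)

/-- The modular `ρ_l(f) = ∫_{p < ∞} (|f| / l) ^ p + l⁻¹ ‖f‖_{L^∞(p = ∞)}`. -/
def varModular {n : ℕ} (Ω : Set (EuclideanSpace ℝ (Fin n)))
    (p : EuclideanSpace ℝ (Fin n) → ℝ≥0∞) (l : ℝ) (f : EuclideanSpace ℝ (Fin n) → ℝ) : ℝ≥0∞ :=
  (∫⁻ x in {x ∈ Ω | p x ≠ ∞}, ENNReal.ofReal ((|f x| / l) ^ (p x).toReal))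
    + ENNReal.ofReal l⁻¹ * eLpNormEssSup f (volume.restrict {x ∈ Ω | p x = ∞})

/-- The variable Lebesgue space `L^{p(·)}(Ω)`, as a set of (representatives of) functions. -/
def variableLebesgue {n : ℕ} (Ω : Set (EuclideanSpace ℝ (Fin n)))
    (p : EuclideanSpace ℝ (Fin n) → ℝ≥0∞) : Set (EuclideanSpace ℝ (Fin n) → ℝ) :=
  {f | AEMeasurable f (volume.restrict Ω) ∧ ∃ l : ℝ, 0 < l ∧ varModular Ω p l f < ∞}

/-- The Luxemburg norm of `L^{p(·)}(Ω)`, equal to `∞` if there is no admissible `l`. -/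
def varNorm {n : ℕ} (Ω : Set (EuclideanSpace ℝ (Fin n)))
    (p : EuclideanSpace ℝ (Fin n) → ℝ≥0∞) (f : EuclideanSpace ℝ (Fin n) → ℝ) : ℝ≥0∞ :=
  ⨅ (l : ℝ) (_ : 0 < l ∧ varModular Ω p l f ≤ 1), ENNReal.ofReal l

/-- `∫_Ω M(|f| / l)`. -/
def orliczModular {n : ℕ} (Ω : Set (EuclideanSpace ℝ (Fin n)))
    (M : ℝ → ℝ) (l : ℝ) (f : EuclideanSpace ℝ (Fin n) → ℝ) : ℝ≥0∞ :=
  ∫⁻ x in Ω, ENNReal.ofReal (M (|f x| / l))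

/-- The Orlicz space `L_M(Ω)`, as a set of (representatives of) functions. -/
def orliczSpace {n : ℕ} (Ω : Set (EuclideanSpace ℝ (Fin n)))
    (M : ℝ → ℝ) : Set (EuclideanSpace ℝ (Fin n) → ℝ) :=
  {f | AEMeasurable f (volume.restrict Ω) ∧ ∃ l : ℝ, 0 < l ∧ orliczModular Ω M l f < ∞}

/-- The Luxemburg norm of `L_M(Ω)`, equal to `∞` if there is no admissible `l`. -/
def orliczNorm {n : ℕ} (Ω : Set (EuclideanSpace ℝ (Fin n)))
    (M : ℝ → ℝ) (f : EuclideanSpace ℝ (Fin n) → ℝ) : ℝ≥0∞ :=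
  ⨅ (l : ℝ) (_ : 0 < l ∧ orliczModular Ω M l f ≤ 1), ENNReal.ofReal l

/-- The Young function `t (log (e + t)) ^ α` of the Zygmund space `L(log L)^α`. -/
def zygmundYoung (α : ℝ) (t : ℝ) : ℝ :=
  t * Real.log (Real.exp 1 + t) ^ α

/-- The Zygmund space `L(log L)^α(Ω)`. -/
def zygmundSpace {n : ℕ} (Ω : Set (EuclideanSpace ℝ (Fin n))) (α : ℝ) :
    Set (EuclideanSpace ℝ (Fin n) → ℝ) :=
  orliczSpace Ω (zygmundYoung α)

end

/-!
Both parts compare the sizes of the bands where `p` is about `1 + 1 / k` with the level at which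
`M t = t (log (e + t)) ^ α` and `t ^ (1 + 1 / k)` balance. This level is, up to a factor `D ^ k`,
`T = w ^ (α k)` with `w = k log k`: there `log T` is comparable to `w` and `T ^ (1 / k)` is
comparable to `w ^ α`. For `l = 1 / k` the bounds in the hypotheses are `(C / w ^ α) ^ k` and
`(θ k / w ^ α) ^ k`, so it is enough to use these values of `l`.

For the embedding, above the level `T k = (w ^ α / D) ^ (k + 1)` one has `M t ≤ A t ^ p` on the band
with `A` independent of `k` (`zygmundYoung_le_mul_rpow`, `log_add_rpow_le_truncLevel`), and below it
`M t ≤ M (T k)`. Hence `M t ≤ A t ^ p + G`, where `G` sums `M (T k)` over the sets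
`{p ≤ 1 + 1 / k}`; with `D = 2 C` its integral is a convergent series
(`zygmundYoung_truncLevel_mul_le`). The modular inequality thus obtained
(`exists_orliczModular_le`) gives the norm inequality by convexity (`embedding_of_modular_le`).

For the failure of the embedding, one may replace `θ k` by `y = min (θ k) (w ^ (α / 2))`, which still
tends to infinity. At the level `T = (w ^ α / y) ^ k` the set `{p ≤ 1 + 1 / k}` has measure at least
`c / T`, while `M T` exceeds `T ^ (1 + 1 / k)` by a factor proportional to `y`
(`mul_rpow_le_zygmundYoung`). Superposing constants `T` on small subsets along a sequence with
`y ≥ const * 4 ^ j` yields a function in `L^{p(·)}` outside the Zygmund space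
(`not_subset_zygmundSpace_of_levels`).
-/

/-! ### The Zygmund function -/

theorem one_le_log_exp_one_add {t : ℝ} (ht : 0 ≤ t) : 1 ≤ Real.log (Real.exp 1 + t) := by
  rw [Real.le_log_iff_exp_le (by positivity)]
  linarith

theorem zygmundYoung_nonneg (α : ℝ) {t : ℝ} (ht : 0 ≤ t) : 0 ≤ zygmundYoung α t :=
  mul_nonneg ht (Real.rpow_nonneg (zero_le_one.trans (one_le_log_exp_one_add ht)) α)

theorem zygmundYoung_mono {α : ℝ} (hα : 0 ≤ α) {s t : ℝ} (hs : 0 ≤ s) (hst : s ≤ t) :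
    zygmundYoung α s ≤ zygmundYoung α t := by
  have h0 := one_le_log_exp_one_add hs
  have h1 : Real.log (Real.exp 1 + s) ≤ Real.log (Real.exp 1 + t) :=
    Real.log_le_log (by positivity) (by linarith)
  exact mul_le_mul hst (Real.rpow_le_rpow (by linarith) h1 hα)
    (Real.rpow_nonneg (by linarith) _) (hs.trans hst)

theorem le_zygmundYoung {α : ℝ} (hα : 0 ≤ α) {t : ℝ} (ht : 0 ≤ t) : t ≤ zygmundYoung α t :=
  le_mul_of_one_le_right ht (Real.one_le_rpow (one_le_log_exp_one_add ht) hα)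

theorem zygmundYoung_div_le {α : ℝ} (hα : 0 ≤ α) {t K : ℝ} (ht : 0 ≤ t) (hK : 1 ≤ K) :
    zygmundYoung α (t / K) ≤ zygmundYoung α t / K := by
  have hK0 : 0 < K := by linarith
  have h0 : 0 ≤ t / K := by positivity
  have h1 : t / K ≤ t := div_le_self ht hK
  have h2 : Real.log (Real.exp 1 + t / K) ≤ Real.log (Real.exp 1 + t) :=
    Real.log_le_log (by positivity) (by linarith)
  have h3 := one_le_log_exp_one_add h0
  unfold zygmundYoung
  rw [mul_div_right_comm]
  exact mul_le_mul_of_nonneg_left (Real.rpow_le_rpow (by linarith) h2 hα) h0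

/-- A quantitative form of the doubling property of the Zygmund function. The logarithm loses at
most a factor `L` when its argument is divided by `L`, by Bernoulli's inequality. -/
theorem zygmundYoung_le_mul_div {α : ℝ} (hα : 0 ≤ α) {t L : ℝ} (ht : 0 ≤ t) (hL : 1 ≤ L) :
    zygmundYoung α t ≤ L * L ^ α * zygmundYoung α (t / L) := by
  have hL0 : 0 < L := by linarith
  have h0 : 0 ≤ t / L := by positivity
  have he := Real.exp_pos 1
  have hlog : Real.log (Real.exp 1 + t) ≤ L * Real.log (Real.exp 1 + t / L) := by
    rw [← Real.log_rpow (by positivity)]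
    apply Real.log_le_log (by positivity)
    have hb := one_add_mul_self_le_rpow_one_add (s := t / L / Real.exp 1)
      (by have : 0 ≤ t / L / Real.exp 1 := by positivity
          linarith) hL
    have h1 : Real.exp 1 + t / L = Real.exp 1 * (1 + t / L / Real.exp 1) := by field_simp
    have h2 : L * (t / L / Real.exp 1) = t / Real.exp 1 := by field_simp
    rw [h1, Real.mul_rpow he.le (by positivity)]
    rw [h2] at hb
    have h3 : Real.exp 1 ≤ Real.exp 1 ^ L :=
      Real.self_le_rpow_of_one_le (Real.one_le_exp zero_le_one) hL
    calc Real.exp 1 + t = Real.exp 1 * (1 + t / Real.exp 1) := by field_simp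
      _ ≤ _ := mul_le_mul h3 hb (by positivity) (by positivity)
  have h3 := one_le_log_exp_one_add h0
  have h4 := one_le_log_exp_one_add ht
  unfold zygmundYoung
  calc t * Real.log (Real.exp 1 + t) ^ α
      ≤ t * (L * Real.log (Real.exp 1 + t / L)) ^ α := by
        gcongr
    _ = _ := by
        rw [Real.mul_rpow hL0.le (by linarith)]
        field_simp

/-- If a power `t ^ N⁻¹` dominates the logarithmic factor at `t = T` with enough room, then it does
so for all `t ≥ T`. -/
theorem log_rpow_le_mul_rpow {α N T A t : ℝ} (hα : 0 < α) (hN : 0 < N) (hT : 1 ≤ T)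
    (hA : (Real.log (Real.exp 1 + T) + α * N) ^ α ≤ A * T ^ N⁻¹) (ht : T ≤ t) :
    Real.log (Real.exp 1 + t) ^ α ≤ A * t ^ N⁻¹ := by
  have hT0 : 0 < T := by linarith
  -- Write `t = T * u` and use `log u ≤ α N u ^ (1 / (α N))`.
  obtain ⟨u, rfl⟩ : ∃ u, t = T * u := ⟨t / T, by field_simp⟩
  have hu : 1 ≤ u := by
    by_contra h
    push Not at h
    nlinarith
  have hu0 : 0 < u := by linarith
  have hlT := one_le_log_exp_one_add hT0.le
  have h1 : Real.log (Real.exp 1 + T * u) ≤ Real.log (Real.exp 1 + T) + Real.log u := by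
    rw [← Real.log_mul (by positivity) (by positivity)]
    apply Real.log_le_log (by positivity)
    have := Real.exp_pos 1
    nlinarith
  have h2 : Real.log u ≤ α * N * u ^ (α * N)⁻¹ := by
    have := Real.log_le_rpow_div hu0.le (ε := (α * N)⁻¹) (by positivity)
    rwa [div_inv_eq_mul, mul_comm] at this
  have h3 : 1 ≤ u ^ (α * N)⁻¹ := Real.one_le_rpow hu (by positivity)
  have h4 : Real.log (Real.exp 1 + T * u)
      ≤ (Real.log (Real.exp 1 + T) + α * N) * u ^ (α * N)⁻¹ := by nlinarith
  have h5 := one_le_log_exp_one_add (t := T * u) (by positivity)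
  calc Real.log (Real.exp 1 + T * u) ^ α
      ≤ ((Real.log (Real.exp 1 + T) + α * N) * u ^ (α * N)⁻¹) ^ α :=
        Real.rpow_le_rpow (by linarith) h4 hα.le
    _ = (Real.log (Real.exp 1 + T) + α * N) ^ α * u ^ N⁻¹ := by
        rw [Real.mul_rpow (by positivity) (by positivity), ← Real.rpow_mul hu0.le]
        congr 2
        field_simp
    _ ≤ A * T ^ N⁻¹ * u ^ N⁻¹ := by gcongr
    _ = A * (T * u) ^ N⁻¹ := by rw [Real.mul_rpow hT0.le hu0.le, mul_assoc]

theorem zygmundYoung_le_mul_rpow {α N T A q t : ℝ} (hα : 0 < α) (hN : 0 < N) (hT : 1 ≤ T)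
    (hA : (Real.log (Real.exp 1 + T) + α * N) ^ α ≤ A * T ^ N⁻¹) (hA0 : 0 ≤ A)
    (hq : 1 + N⁻¹ ≤ q) (ht : T ≤ t) : zygmundYoung α t ≤ A * t ^ q := by
  have ht0 : 0 < t := by linarith
  calc zygmundYoung α t ≤ t * (A * t ^ N⁻¹) :=
        mul_le_mul_of_nonneg_left (log_rpow_le_mul_rpow hα hN hT hA ht) ht0.le
    _ = A * t ^ (1 + N⁻¹) := by rw [Real.rpow_add ht0, Real.rpow_one]; ring
    _ ≤ A * t ^ q := by
        gcongr
        exact hT.trans ht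

/-! ### Truncation levels -/

/-- The truncation level for the band where `p` is about `1 + 1 / k`. The power is `k + 1`, so that
the `(k + 1)`-th root, which bounds the gain `t ^ (p - 1)` on the band
`1 + 1 / (k + 1) < p ≤ 1 + 1 / k` from below, is exactly `(k log k) ^ α / D`. -/
noncomputable def truncLevel (α D : ℝ) (k : ℕ) : ℝ := ((k * Real.log k) ^ α / D) ^ (k + 1)

theorem natCast_log_bounds {k : ℕ} (hk : 3 ≤ k) :
    1 ≤ Real.log k ∧ Real.log k ≤ k ∧ (3 : ℝ) ≤ k := by
  have h3 : (3 : ℝ) ≤ k := by exact_mod_cast hk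
  refine ⟨?_, Real.log_le_self (by linarith), h3⟩
  rw [Real.le_log_iff_exp_le (by linarith)]
  linarith [Real.exp_one_lt_d9]

theorem log_exp_one_add_truncLevel_le {α D : ℝ} (hα : 0 < α) (hD : 1 ≤ D) {k : ℕ} (hk : 3 ≤ k)
    (hT : 1 ≤ truncLevel α D k) :
    Real.log (Real.exp 1 + truncLevel α D k) + α * (k + 1) ≤ (2 + 6 * α) * (k * Real.log k) := by
  obtain ⟨hl1, hlk, hk3⟩ := natCast_log_bounds hk
  have hw : 0 < (k : ℝ) * Real.log k := by positivity
  have h1 : Real.log (Real.exp 1 + truncLevel α D k) ≤ 2 + Real.log (truncLevel α D k) := by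
    have : (2 : ℝ) = Real.log (Real.exp 2) := by simp
    rw [this, ← Real.log_mul (by positivity) (by positivity)]
    apply Real.log_le_log (by positivity)
    have h2 : Real.exp 2 = Real.exp 1 * Real.exp 1 := by rw [← Real.exp_add]; norm_num
    have h3 : 2 ≤ Real.exp 1 := by linarith [Real.add_one_le_exp 1]
    have h4 : Real.exp 1 * 1 ≤ Real.exp 1 * truncLevel α D k := by gcongr
    rw [h2]
    nlinarith [mul_le_mul_of_nonneg_right h3
      (show 0 ≤ Real.exp 1 * truncLevel α D k by positivity)]
  have h2 : Real.log (truncLevel α D k) ≤ (k + 1) * (α * (2 * Real.log k)) := by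
    unfold truncLevel
    rw [Real.log_pow, Real.log_div (by positivity) (by positivity), Real.log_rpow hw,
      Real.log_mul (by positivity) (by positivity)]
    push_cast
    have h4 : 0 ≤ Real.log D := Real.log_nonneg hD
    have h5 : Real.log (Real.log k) ≤ Real.log k := Real.log_le_log (by linarith) hlk
    have : α * (Real.log k + Real.log (Real.log k)) ≤ α * (2 * Real.log k) := by
      gcongr; linarith
    gcongr
    linarith
  have h6 : (k : ℝ) ≤ k * Real.log k := by nlinarith
  have h7 : Real.log k ≤ k * Real.log k := by nlinarith
  nlinarith [mul_le_mul_of_nonneg_left h6 hα.le, mul_le_mul_of_nonneg_left h7 hα.le]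

theorem tendsto_natCast_mul_log : Tendsto (fun k : ℕ => (k : ℝ) * Real.log k) atTop atTop :=
  tendsto_natCast_atTop_atTop.atTop_mul_atTop₀
    (Real.tendsto_log_atTop.comp tendsto_natCast_atTop_atTop)

theorem eventually_one_le_truncLevel {α D : ℝ} (hα : 0 < α) (hD : 1 ≤ D) :
    ∀ᶠ k : ℕ in atTop, 1 ≤ truncLevel α D k := by
  filter_upwards [((tendsto_rpow_atTop hα).comp tendsto_natCast_mul_log).eventually_ge_atTop D]
    with k hk
  exact one_le_pow₀ ((one_le_div (by linarith)).2 hk)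

theorem truncLevel_rpow_inv {α D : ℝ} (hD : 1 ≤ D) {k : ℕ} (hk : 3 ≤ k) :
    truncLevel α D k ^ ((k : ℝ) + 1)⁻¹ = (k * Real.log k) ^ α / D := by
  obtain ⟨hl1, hlk, hk3⟩ := natCast_log_bounds hk
  have hw : 0 < (k : ℝ) * Real.log k := by positivity
  have := Real.pow_rpow_inv_natCast (x := (k * Real.log k) ^ α / D) (by positivity)
    (Nat.succ_ne_zero k)
  push_cast at this
  exact this

theorem log_add_rpow_le_truncLevel {α D : ℝ} (hα : 0 < α) (hD : 1 ≤ D) {k : ℕ} (hk : 3 ≤ k)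
    (hT : 1 ≤ truncLevel α D k) :
    (Real.log (Real.exp 1 + truncLevel α D k) + α * (k + 1)) ^ α
      ≤ ((2 + 6 * α) ^ α * D) * truncLevel α D k ^ ((k : ℝ) + 1)⁻¹ := by
  obtain ⟨hl1, hlk, hk3⟩ := natCast_log_bounds hk
  have hw : 0 < (k : ℝ) * Real.log k := by positivity
  have h0 := one_le_log_exp_one_add (zero_le_one.trans hT)
  rw [truncLevel_rpow_inv hD hk]
  calc _ ≤ ((2 + 6 * α) * (k * Real.log k)) ^ α :=
        Real.rpow_le_rpow (by positivity) (log_exp_one_add_truncLevel_le hα hD hk hT) hα.le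
    _ = _ := by rw [Real.mul_rpow (by positivity) hw.le]; field_simp

/-- With `D = 2 C`, the measure bound `(C / (k log k) ^ α) ^ k` of the band beats the value of the
Zygmund function at the truncation level by a geometric factor. -/
theorem zygmundYoung_truncLevel_mul_le {α C : ℝ} (hα : 0 < α) (hC : 1 < C) {k : ℕ} (hk : 3 ≤ k)
    (hT : 1 ≤ truncLevel α (2 * C) k) :
    zygmundYoung α (truncLevel α (2 * C) k) * (C / (k * Real.log k) ^ α) ^ k
      ≤ (2 + 6 * α) ^ α * ((k : ℝ) ^ ⌈4 * α⌉₊ * (1 / 2) ^ k) := by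
  obtain ⟨hl1, hlk, hk3⟩ := natCast_log_bounds hk
  have hw : 0 < (k : ℝ) * Real.log k := by positivity
  have hD : 1 ≤ 2 * C := by linarith
  set w := (k : ℝ) * Real.log k with hwdef
  have hwk : w ≤ (k : ℝ) ^ (2 : ℝ) := by
    rw [Real.rpow_two, sq]
    exact mul_le_mul_of_nonneg_left hlk (by positivity)
  have h1 : Real.log (Real.exp 1 + truncLevel α (2 * C) k) ≤ (2 + 6 * α) * w := by
    have := log_exp_one_add_truncLevel_le hα hD hk hT
    have h2 : 0 ≤ α * (k + 1) := by positivity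
    linarith
  have h0 := one_le_log_exp_one_add (zero_le_one.trans hT)
  have h2 : truncLevel α (2 * C) k * (C / w ^ α) ^ k = (1 / 2) ^ k * (w ^ α / (2 * C)) := by
    unfold truncLevel
    rw [← hwdef, pow_succ, mul_right_comm, ← mul_pow]
    congr 2
    field_simp
  have h3 : w ^ α * w ^ α ≤ (k : ℝ) ^ ⌈4 * α⌉₊ := by
    calc w ^ α * w ^ α ≤ ((k : ℝ) ^ (2 : ℝ)) ^ α * ((k : ℝ) ^ (2 : ℝ)) ^ α := by gcongr
      _ = (k : ℝ) ^ (4 * α) := by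
        rw [← Real.rpow_mul (by positivity), ← Real.rpow_add (by positivity)]
        ring_nf
      _ ≤ (k : ℝ) ^ (⌈4 * α⌉₊ : ℝ) :=
        Real.rpow_le_rpow_of_exponent_le (by linarith) (Nat.le_ceil _)
      _ = _ := Real.rpow_natCast _ _
  calc _ = truncLevel α (2 * C) k * (C / w ^ α) ^ k
          * Real.log (Real.exp 1 + truncLevel α (2 * C) k) ^ α := by unfold zygmundYoung; ring
    _ ≤ (1 / 2) ^ k * w ^ α * ((2 + 6 * α) * w) ^ α := by
        rw [h2]
        gcongr
        exact div_le_self (by positivity) hD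
    _ = (2 + 6 * α) ^ α * (w ^ α * w ^ α * (1 / 2) ^ k) := by
        rw [Real.mul_rpow (by positivity) hw.le]; ring
    _ ≤ _ := by gcongr

/-! ### The embedding under a bound on the measure of the bands -/

theorem IsExponent.nullMeasurableSet_le {n : ℕ} {Ω : Set (EuclideanSpace ℝ (Fin n))}
    {p : EuclideanSpace ℝ (Fin n) → ℝ≥0∞} (hp : IsExponent Ω p) (c : ℝ≥0∞) :
    NullMeasurableSet {x | p x ≤ c} (volume.restrict Ω) :=
  hp.aemeasurable.nullMeasurableSet_preimage measurableSet_Iic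

theorem ae_ne_top_of_exponentSup_lt_top {n : ℕ} {Ω : Set (EuclideanSpace ℝ (Fin n))}
    {p : EuclideanSpace ℝ (Fin n) → ℝ≥0∞} (hbdd : exponentSup Ω p < ∞) :
    ∀ᵐ x ∂volume.restrict Ω, p x ≠ ∞ := by
  filter_upwards [ENNReal.ae_le_essSup (μ := volume.restrict Ω) p] with x hx
  exact (hx.trans_lt hbdd).ne

/-- For a bounded exponent, the modular reduces to its integral part over all of `Ω`. -/
theorem varModular_eq_lintegral {n : ℕ} {Ω : Set (EuclideanSpace ℝ (Fin n))} (hΩ : IsOpen Ω)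
    {p : EuclideanSpace ℝ (Fin n) → ℝ≥0∞} (hbdd : exponentSup Ω p < ∞) (l : ℝ)
    (f : EuclideanSpace ℝ (Fin n) → ℝ) :
    varModular Ω p l f = ∫⁻ x in Ω, ENNReal.ofReal ((|f x| / l) ^ (p x).toReal) := by
  have h := ae_ne_top_of_exponentSup_lt_top hbdd
  rw [ae_restrict_iff' hΩ.measurableSet] at h
  have h1 : ({x ∈ Ω | p x ≠ ∞} : Set _) =ᵐ[volume] Ω := by
    filter_upwards [h] with x hx
    exact propext ⟨fun h => h.1, fun h => ⟨h, hx h⟩⟩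
  have h2 : ({x ∈ Ω | p x = ∞} : Set _) =ᵐ[volume] (∅ : Set (EuclideanSpace ℝ (Fin n))) := by
    filter_upwards [h] with x hx
    exact propext ⟨fun h => hx h.1 h.2, fun h => h.elim⟩
  unfold varModular
  rw [Measure.restrict_congr_set h1, Measure.restrict_congr_set h2]
  simp

/-- If the sets `{p ≤ 1 + 1 / k}` shrink so fast that `∑ M(T k) |{p ≤ 1 + 1 / k}|` converges, where
`T k` is a level above which `M` is dominated by `A t ^ (1 + 1 / (k + 1))`, then the Zygmund modular
is bounded by the modular of `L^{p(·)}` up to constants. Pointwise, `M t ≤ A t ^ p + G`, where `G`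
adds up the values `M(T k)` over the sets `{p ≤ 1 + 1 / k}`. -/
theorem exists_orliczModular_le {n : ℕ} {Ω : Set (EuclideanSpace ℝ (Fin n))} (hΩ : IsOpen Ω)
    (hfin : volume Ω < ∞) {p : EuclideanSpace ℝ (Fin n) → ℝ≥0∞} (hp : IsExponent Ω p)
    (hbdd : exponentSup Ω p < ∞) {α : ℝ} (hα : 0 < α) {A : ℝ} {T : ℕ → ℝ} {k₀ : ℕ}
    (hk₀ : 1 ≤ k₀) (hT : ∀ k, k₀ ≤ k → 1 ≤ T k)
    (hA : ∀ k, k₀ ≤ k → ∀ t q : ℝ, T k ≤ t → 1 + ((k : ℝ) + 1)⁻¹ ≤ q →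
      zygmundYoung α t ≤ A * t ^ q)
    (hsum : ∑' j : ℕ, ENNReal.ofReal (zygmundYoung α (T (k₀ + j))) *
      volume {x ∈ Ω | p x ≤ 1 + ENNReal.ofReal ((k₀ + j : ℕ) : ℝ)⁻¹} ≠ ∞) :
    ∃ a b : ℝ≥0, ∀ (f : EuclideanSpace ℝ (Fin n) → ℝ) (l : ℝ), 0 < l →
      orliczModular Ω (zygmundYoung α) l f ≤ a * varModular Ω p l f + b := by
  have hM : ∀ k, k₀ ≤ k → 1 ≤ zygmundYoung α (T k) := fun k hk =>
    (hT k hk).trans (le_zygmundYoung hα.le (zero_le_one.trans (hT k hk)))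
  set S : ℕ → Set (EuclideanSpace ℝ (Fin n)) :=
    fun j => {x | p x ≤ 1 + ENNReal.ofReal ((k₀ + j : ℕ) : ℝ)⁻¹} with hS
  have hSm : ∀ j, NullMeasurableSet (S j) (volume.restrict Ω) :=
    fun j => hp.nullMeasurableSet_le _
  have hSv : ∀ j, volume.restrict Ω (S j) =
      volume {x ∈ Ω | p x ≤ 1 + ENNReal.ofReal ((k₀ + j : ℕ) : ℝ)⁻¹} := by
    intro j
    rw [Measure.restrict_apply' hΩ.measurableSet, inter_comm]
    rfl
  simp only [← hSv] at hsum
  -- The series dominates infinitely many copies of `|{p ≤ 1}|`, so this set is null.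
  have hone : ∀ᵐ x ∂volume.restrict Ω, 1 < p x := by
    have h0 : volume.restrict Ω {x | p x ≤ 1} = 0 := by
      by_contra hne
      apply hsum
      rw [← top_le_iff, ← ENNReal.tsum_const_eq_top_of_ne_zero (α := ℕ) hne]
      refine ENNReal.tsum_le_tsum fun j => ?_
      have h1 : (1 : ℝ≥0∞) ≤ ENNReal.ofReal (zygmundYoung α (T (k₀ + j))) := by
        rw [ENNReal.one_le_ofReal]
        exact hM _ (Nat.le_add_right _ _)
      refine le_trans ?_ (le_mul_of_one_le_left (by simp) h1)
      exact measure_mono fun x (hx : p x ≤ 1) => hx.trans le_self_add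
    rw [ae_iff]
    simpa only [not_lt] using h0
  set G : EuclideanSpace ℝ (Fin n) → ℝ≥0∞ := fun x =>
    ENNReal.ofReal (zygmundYoung α (T k₀)) + ∑' j : ℕ,
      (S j).indicator (fun _ => ENNReal.ofReal (zygmundYoung α (T (k₀ + j)))) x with hG
  have hGs : AEMeasurable (fun x => ∑' j : ℕ,
      (S j).indicator (fun _ => ENNReal.ofReal (zygmundYoung α (T (k₀ + j)))) x)
      (volume.restrict Ω) :=
    AEMeasurable.tsum fun j => aemeasurable_const.indicator₀ (hSm j)
  have hGm : AEMeasurable G (volume.restrict Ω) := aemeasurable_const.add hGs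
  have hGi : ∫⁻ x in Ω, G x ≠ ∞ := by
    rw [hG, lintegral_add_left measurable_const, lintegral_tsum]
    · rw [lintegral_const, Measure.restrict_apply_univ]
      refine ENNReal.add_ne_top.2 ⟨ENNReal.mul_ne_top ENNReal.ofReal_ne_top hfin.ne, ?_⟩
      simpa only [lintegral_indicator_const₀ (hSm _)] using hsum
    · exact fun j => aemeasurable_const.indicator₀ (hSm j)
  refine ⟨A.toNNReal, (∫⁻ x in Ω, G x).toNNReal, fun f l hl => ?_⟩
  rw [varModular_eq_lintegral hΩ hbdd, ENNReal.coe_toNNReal hGi,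
    ← lintegral_const_mul' _ _ ENNReal.coe_ne_top, ← lintegral_add_right' _ hGm]
  refine lintegral_mono_ae ?_
  filter_upwards [hone, ae_ne_top_of_exponentSup_lt_top hbdd] with x hx1 hxt
  set t := |f x| / l with ht
  have ht0 : 0 ≤ t := by positivity
  set q := (p x).toReal with hq
  have hpq : p x = ENNReal.ofReal q := (ENNReal.ofReal_toReal hxt).symm
  have hq1 : 1 < q := by
    rw [hpq, ENNReal.one_lt_ofReal] at hx1
    exact hx1
  have hbound : ∀ k, k₀ ≤ k → 1 + ((k : ℝ) + 1)⁻¹ ≤ q →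
      ENNReal.ofReal (zygmundYoung α (T k)) ≤ G x →
      ENNReal.ofReal (zygmundYoung α t) ≤ A.toNNReal * ENNReal.ofReal (t ^ q) + G x := by
    intro k hk hkq hkG
    rcases le_total (T k) t with h | h
    · refine le_trans ?_ le_self_add
      change _ ≤ ENNReal.ofReal A * _
      rw [← ENNReal.ofReal_mul' (by positivity)]
      exact ENNReal.ofReal_le_ofReal (hA k hk t q h hkq)
    · exact ((ENNReal.ofReal_le_ofReal (zygmundYoung_mono hα.le ht0 h)).trans hkG).trans
        le_add_self
  -- The band of `x`: `1 + 1 / (k + 1) < q ≤ 1 + 1 / k`.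
  have hq0 : 0 < q - 1 := by linarith
  set k := ⌊(q - 1)⁻¹⌋₊ with hk
  have hk1 : (k : ℝ) ≤ (q - 1)⁻¹ := Nat.floor_le (by positivity)
  have hk2 : (q - 1)⁻¹ < k + 1 := Nat.lt_floor_add_one _
  rcases le_or_gt k₀ k with h | h
  · refine hbound k h ?_ ?_
    · have := (inv_lt_comm₀ hq0 (by positivity)).1 hk2
      linarith
    · obtain ⟨j, hj⟩ := Nat.exists_eq_add_of_le h
      have hk0 : (0 : ℝ) < k := by exact_mod_cast hk₀.trans h
      have hxS : x ∈ S j := by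
        have h3 := (le_inv_comm₀ hk0 hq0).1 hk1
        change p x ≤ 1 + ENNReal.ofReal ((k₀ + j : ℕ) : ℝ)⁻¹
        rw [← hj, hpq, ← ENNReal.ofReal_one, ← ENNReal.ofReal_add zero_le_one (by positivity)]
        exact ENNReal.ofReal_le_ofReal (by linarith)
      refine le_trans ?_ le_add_self
      refine le_trans ?_ (ENNReal.le_tsum j)
      rw [indicator_of_mem hxS, ← hj]
  · refine hbound k₀ le_rfl ?_ le_self_add
    have h3 : (k : ℝ) + 1 ≤ k₀ := by exact_mod_cast h
    have h4 : (q - 1)⁻¹ < (k₀ : ℝ) + 1 := by linarith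
    have := (inv_lt_comm₀ hq0 (by positivity)).1 h4
    linarith

/-- A modular bound with constants gives the norm bound, by convexity of the Zygmund function. -/
theorem embedding_of_modular_le {n : ℕ} {Ω : Set (EuclideanSpace ℝ (Fin n))}
    {p : EuclideanSpace ℝ (Fin n) → ℝ≥0∞} {α : ℝ} (hα : 0 < α) {a b : ℝ≥0}
    (hab : ∀ (f : EuclideanSpace ℝ (Fin n) → ℝ) (l : ℝ), 0 < l →
      orliczModular Ω (zygmundYoung α) l f ≤ a * varModular Ω p l f + b) :
    variableLebesgue Ω p ⊆ zygmundSpace Ω α ∧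
      ∃ K : ℝ≥0, ∀ f ∈ variableLebesgue Ω p,
        orliczNorm Ω (zygmundYoung α) f ≤ K * varNorm Ω p f := by
  refine ⟨fun f hf => ⟨hf.1, ?_⟩, 1 + a + b, fun f hf => ?_⟩
  · obtain ⟨l, hl, h⟩ := hf.2
    exact ⟨l, hl, (hab f l hl).trans_lt
      (ENNReal.add_lt_top.2 ⟨ENNReal.mul_lt_top ENNReal.coe_lt_top h, ENNReal.coe_lt_top⟩)⟩
  · set K : ℝ≥0 := 1 + a + b with hK
    have hK1 : 1 ≤ K := by rw [hK, add_assoc]; exact le_self_add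
    have hK0 : (K : ℝ≥0∞) ≠ 0 := by
      have : K ≠ 0 := (zero_lt_one.trans_le hK1).ne'
      exact_mod_cast this
    have hK1' : (1 : ℝ) ≤ K := by exact_mod_cast hK1
    unfold varNorm
    rw [ENNReal.mul_iInf_of_ne hK0 ENNReal.coe_ne_top]
    refine le_iInf fun l => ?_
    rw [ENNReal.mul_iInf_of_ne hK0 ENNReal.coe_ne_top]
    refine le_iInf fun ⟨hl, hml⟩ => ?_
    have hKl : (K : ℝ≥0∞) * ENNReal.ofReal l = ENNReal.ofReal (K * l) := by
      rw [ENNReal.ofReal_mul K.coe_nonneg, ENNReal.ofReal_coe_nnreal]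
    rw [hKl]
    refine iInf₂_le (K * l) ⟨by positivity, ?_⟩
    have h1 : orliczModular Ω (zygmundYoung α) l f ≤ K := by
      refine (hab f l hl).trans ?_
      rw [hK]
      push_cast
      gcongr
      calc (a : ℝ≥0∞) * varModular Ω p l f ≤ a * 1 := by gcongr
        _ ≤ 1 + a := by rw [mul_one]; exact le_add_self
    have h2 : orliczModular Ω (zygmundYoung α) (K * l) f
        ≤ (K : ℝ≥0∞)⁻¹ * orliczModular Ω (zygmundYoung α) l f := by
      unfold orliczModular
      rw [← lintegral_const_mul' _ _ (ENNReal.inv_ne_top.2 hK0)]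
      refine lintegral_mono fun x => ?_
      have h3 : |f x| / (K * l) = |f x| / l / K := by rw [mul_comm, div_mul_eq_div_div]
      rw [h3]
      refine (ENNReal.ofReal_le_ofReal
        (zygmundYoung_div_le hα.le (by positivity) hK1')).trans ?_
      rw [ENNReal.ofReal_div_of_pos (by positivity), ENNReal.ofReal_coe_nnreal, mul_comm,
        ENNReal.div_eq_inv_mul, mul_comm]
    refine h2.trans ?_
    calc (K : ℝ≥0∞)⁻¹ * orliczModular Ω (zygmundYoung α) l f ≤ (K : ℝ≥0∞)⁻¹ * K := by gcongr
      _ = 1 := ENNReal.inv_mul_cancel hK0 ENNReal.coe_ne_top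

/-- The hypothesis of the embedding at `l = 1 / k`. -/
theorem measure_bound_inv_natCast (C α : ℝ) {k : ℕ} (hk : 3 ≤ k) :
    C ^ (1 / (k : ℝ)⁻¹) * (k : ℝ)⁻¹ ^ (α / (k : ℝ)⁻¹) *
      Real.log (1 / (k : ℝ)⁻¹) ^ (-α / (k : ℝ)⁻¹) = (C / (k * Real.log k) ^ α) ^ k := by
  obtain ⟨hl1, hlk, hk3⟩ := natCast_log_bounds hk
  have hk0 : (0 : ℝ) < k := by linarith
  have hl0 : 0 < Real.log k := by linarith
  simp only [div_inv_eq_mul, one_mul]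
  rw [Real.rpow_natCast, Real.rpow_mul_natCast (by positivity),
    Real.rpow_mul_natCast hl0.le, ← mul_pow, ← mul_pow, Real.mul_rpow hk0.le hl0.le,
    Real.inv_rpow hk0.le, Real.rpow_neg hl0.le]
  congr 1
  field_simp

theorem exists_modular_le_of_measure_le {n : ℕ} {Ω : Set (EuclideanSpace ℝ (Fin n))}
    (hΩ : IsOpen Ω) (hfin : volume Ω < ∞) {p : EuclideanSpace ℝ (Fin n) → ℝ≥0∞}
    (hp : IsExponent Ω p) (hbdd : exponentSup Ω p < ∞) {α : ℝ} (hα : 0 < α) {C : ℝ} (hC : 1 < C)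
    (h : ∀ᶠ l : ℝ in 𝓝[>] 0, volume {x ∈ Ω | p x ≤ 1 + ENNReal.ofReal l} ≤
      ENNReal.ofReal (C ^ (1 / l) * l ^ (α / l) * Real.log (1 / l) ^ (-α / l))) :
    ∃ a b : ℝ≥0, ∀ (f : EuclideanSpace ℝ (Fin n) → ℝ) (l : ℝ), 0 < l →
      orliczModular Ω (zygmundYoung α) l f ≤ a * varModular Ω p l f + b := by
  have hD : 1 ≤ 2 * C := by linarith
  have hev := (tendsto_inv_atTop_nhdsGT_zero.comp tendsto_natCast_atTop_atTop).eventually h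
  obtain ⟨k₀, hk₀⟩ := eventually_atTop.1
    ((hev.and (eventually_one_le_truncLevel hα hD)).and (eventually_ge_atTop 3))
  have hk3 : ∀ k, k₀ ≤ k → 3 ≤ k := fun k hk => (hk₀ k hk).2
  have hT : ∀ k, k₀ ≤ k → 1 ≤ truncLevel α (2 * C) k := fun k hk => (hk₀ k hk).1.2
  refine exists_orliczModular_le hΩ hfin hp hbdd hα (A := (2 + 6 * α) ^ α * (2 * C))
    (T := truncLevel α (2 * C)) (k₀ := k₀) (by linarith [hk3 k₀ le_rfl]) hT ?_ ?_
  · intro k hk t q ht hq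
    exact zygmundYoung_le_mul_rpow hα (by positivity) (hT k hk)
      (log_add_rpow_le_truncLevel hα hD (hk3 k hk) (hT k hk)) (by positivity) hq ht
  · have hs : Summable fun k : ℕ =>
        (2 + 6 * α) ^ α * ((k : ℝ) ^ ⌈4 * α⌉₊ * (1 / 2) ^ k) :=
      (summable_pow_mul_geometric_of_norm_lt_one (R := ℝ) ⌈4 * α⌉₊ (r := 1 / 2)
        (by norm_num)).mul_left _
    have hs' := hs.comp_injective (add_right_injective k₀)
    refine ne_top_of_le_ne_top hs'.tsum_ofReal_ne_top (ENNReal.tsum_le_tsum fun j => ?_)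
    have hj : k₀ ≤ k₀ + j := Nat.le_add_right _ _
    have h1 := (hk₀ _ hj).1.1
    simp only [Function.comp_apply] at h1
    rw [measure_bound_inv_natCast C α (hk3 _ hj)] at h1
    refine (mul_le_mul_right h1 _).trans ?_
    rw [← ENNReal.ofReal_mul (zygmundYoung_nonneg α (zero_le_one.trans (hT _ hj)))]
    exact ENNReal.ofReal_le_ofReal (zygmundYoung_truncLevel_mul_le hα hC (hk3 _ hj) (hT _ hj))

/-! ### Subsets of prescribed measure -/

/-- Sets of finite Haar measure in a normed space contain subsets of every smaller measure: the
measure of the intersection with a ball depends continuously on the radius. -/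
theorem exists_subset_measure_eq {E : Type*} [NormedAddCommGroup E] [NormedSpace ℝ E]
    [MeasurableSpace E] [BorelSpace E] [FiniteDimensional ℝ E] [Nontrivial E]
    (μ : Measure E) [μ.IsAddHaarMeasure] {A : Set E} (hA : MeasurableSet A) (hfin : μ A ≠ ∞)
    {a : ℝ≥0∞} (ha : a ≤ μ A) : ∃ B ⊆ A, MeasurableSet B ∧ μ B = a := by
  rcases ha.eq_or_lt with rfl | ha
  · exact ⟨A, Subset.rfl, hA, rfl⟩
  set g : ℝ → ℝ := fun r => μ.real (A ∩ Metric.closedBall 0 r)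
  set h : ℝ → ℝ := fun r => μ.real (Metric.closedBall (0 : E) r)
  have hmono : ∀ r s, r ≤ s → |g s - g r| ≤ |h s - h r| := by
    intro r s hrs
    have hsub : Metric.closedBall (0 : E) r ⊆ Metric.closedBall 0 s :=
      Metric.closedBall_subset_closedBall hrs
    have hfs : μ (Metric.closedBall (0 : E) s) ≠ ∞ := measure_closedBall_lt_top.ne
    have h1 : g r ≤ g s := measureReal_mono (inter_subset_inter_right _ hsub)
      (ne_top_of_le_ne_top hfs (measure_mono inter_subset_right))
    have h2 : h s - h r = μ.real (Metric.closedBall (0 : E) s \ Metric.closedBall 0 r) :=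
      (measureReal_sdiff (μ := μ) hsub measurableSet_closedBall).symm
    have h3 : g s ≤ g r + μ.real (Metric.closedBall (0 : E) s \ Metric.closedBall 0 r) := by
      refine (measureReal_mono ?_ ?_).trans (measureReal_union_le _ _)
      · intro x hx
        by_cases hxr : x ∈ Metric.closedBall (0 : E) r
        · exact Or.inl ⟨hx.1, hxr⟩
        · exact Or.inr ⟨hx.2, hxr⟩
      · refine ne_top_of_le_ne_top hfs (measure_mono (union_subset ?_ sdiff_subset))
        exact inter_subset_right.trans hsub
    rw [abs_of_nonneg (by linarith), h2, abs_of_nonneg measureReal_nonneg]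
    linarith
  have hmono' : ∀ r s, |g s - g r| ≤ |h s - h r| := by
    intro r s
    rcases le_total r s with hrs | hrs
    · exact hmono r s hrs
    · rw [abs_sub_comm, abs_sub_comm (h s)]
      exact hmono s r hrs
  have hhc : ContinuousOn h (Ici 0) := by
    have : ContinuousOn
        (fun r : ℝ => r ^ Module.finrank ℝ E * μ.real (Metric.closedBall (0 : E) 1)) (Ici 0) := by
      fun_prop
    exact this.congr fun r hr => Measure.addHaar_real_closedBall' μ 0 hr
  have hgc : ContinuousOn g (Ici 0) := by
    intro r hr
    have := tendsto_iff_dist_tendsto_zero.1 (hhc r hr)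
    exact tendsto_iff_dist_tendsto_zero.2
      (squeeze_zero (fun _ => dist_nonneg) (fun s => hmono' r s) this)
  have hlim : Tendsto (fun m : ℕ => μ (A ∩ Metric.closedBall 0 (m : ℝ))) atTop (𝓝 (μ A)) := by
    have hm : Monotone fun m : ℕ => A ∩ Metric.closedBall (0 : E) (m : ℝ) := fun i j hij =>
      inter_subset_inter_right _ (Metric.closedBall_subset_closedBall (by exact_mod_cast hij))
    have := tendsto_measure_iUnion_atTop (μ := μ) hm
    rwa [← inter_iUnion, Metric.iUnion_closedBall_nat, inter_univ] at this
  obtain ⟨m, hm⟩ := (hlim.eventually_const_lt ha).exists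
  have hat : a ≠ ∞ := ha.ne_top
  have hft : ∀ r, μ (A ∩ Metric.closedBall 0 r) ≠ ∞ := fun r =>
    ne_top_of_le_ne_top hfin (measure_mono inter_subset_left)
  have hg0 : g 0 = 0 := by
    have : μ (A ∩ Metric.closedBall 0 0) = 0 := by
      refine measure_mono_null inter_subset_right ?_
      rw [Metric.closedBall_zero]
      exact measure_singleton 0
    change (μ (A ∩ Metric.closedBall 0 0)).toReal = 0
    rw [this, ENNReal.toReal_zero]
  have hmem : a.toReal ∈ Icc (g 0) (g m) := by
    rw [hg0]
    exact ⟨ENNReal.toReal_nonneg, ENNReal.toReal_mono (hft m) hm.le⟩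
  obtain ⟨r, -, hr⟩ := intermediate_value_Icc (Nat.cast_nonneg m)
    (hgc.mono Icc_subset_Ici_self) hmem
  exact ⟨A ∩ Metric.closedBall 0 r, inter_subset_left, hA.inter measurableSet_closedBall,
    (ENNReal.toReal_eq_toReal_iff' (hft r) hat).1 hr⟩

/-! ### Failure of the embedding -/

/-- If for every `j` there is a level `T` at which `M T` exceeds `4 ^ j * T ^ (1 + l)` while
`{p ≤ 1 + l}` is large enough to carry modular `c` at that level, then `L^{p(·)}` is not contained
in the Zygmund space. The counterexample is the supremum of `T j` times indicators of sets
`E j ⊆ {p ≤ 1 + l j}` of measure `c 2 ^ (-j) / T j ^ (1 + l j)`: the modulars of the pieces are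
summable, their Zygmund modulars unbounded. -/
theorem not_subset_zygmundSpace_of_levels {n : ℕ} (hn : 1 ≤ n)
    {Ω : Set (EuclideanSpace ℝ (Fin n))} (hΩ : IsOpen Ω) (hfin : volume Ω < ∞)
    {p : EuclideanSpace ℝ (Fin n) → ℝ≥0∞} (hp : IsExponent Ω p) (hbdd : exponentSup Ω p < ∞)
    {α : ℝ} (hα : 0 < α) {c : ℝ} (hc : 0 < c)
    (hlev : ∀ j : ℕ, ∃ l T : ℝ, 0 < l ∧ 1 ≤ T ∧
      ENNReal.ofReal c ≤ volume {x ∈ Ω | p x ≤ 1 + ENNReal.ofReal l} *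
        ENNReal.ofReal (T ^ (1 + l)) ∧
      4 ^ j * T ^ (1 + l) ≤ zygmundYoung α T) :
    ¬ variableLebesgue Ω p ⊆ zygmundSpace Ω α := by
  choose l T hl hT hcV hM using hlev
  have : Nonempty (Fin n) := ⟨⟨0, hn⟩⟩
  have hT0 : ∀ j, 0 < T j := fun j => zero_lt_one.trans_le (hT j)
  have hTl : ∀ j, 0 < T j ^ (1 + l j) := fun j => Real.rpow_pos_of_pos (hT0 j) _
  set p' := hp.aemeasurable.mk p with hp'
  have hpm : Measurable p' := hp.aemeasurable.measurable_mk
  have hpp : ∀ᵐ x ∂volume.restrict Ω, p x = p' x := hp.aemeasurable.ae_eq_mk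
  have hsub : ∀ j, ∃ B ⊆ Ω ∩ {x | p' x ≤ 1 + ENNReal.ofReal (l j)}, MeasurableSet B ∧
      volume B = ENNReal.ofReal (c * (1 / 2) ^ j / T j ^ (1 + l j)) := by
    intro j
    refine exists_subset_measure_eq volume
      (hΩ.measurableSet.inter (measurableSet_le hpm measurable_const))
      (ne_top_of_le_ne_top hfin.ne (measure_mono inter_subset_left)) ?_
    have hV : volume (Ω ∩ {x | p' x ≤ 1 + ENNReal.ofReal (l j)}) =
        volume {x ∈ Ω | p x ≤ 1 + ENNReal.ofReal (l j)} := by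
      refine measure_congr ?_
      filter_upwards [(ae_restrict_iff' hΩ.measurableSet).1 hpp] with x hx
      refine propext ⟨fun h => ⟨h.1, ?_⟩, fun h => ⟨h.1, ?_⟩⟩
      · rw [hx h.1]; exact h.2
      · change p' x ≤ _
        rw [← hx h.1]; exact h.2
    rw [hV, ENNReal.ofReal_div_of_pos (hTl j)]
    refine ENNReal.div_le_of_le_mul (le_trans (ENNReal.ofReal_le_ofReal ?_) (hcV j))
    exact mul_le_of_le_one_right hc.le (pow_le_one₀ (by norm_num) (by norm_num))
  choose E hEsub hEm hEv using hsub
  have hEΩ : ∀ j, E j ⊆ Ω := fun j => (hEsub j).trans inter_subset_left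
  have hEr : ∀ j, volume.restrict Ω (E j) = volume (E j) := fun j =>
    Measure.restrict_eq_self _ (hEΩ j)
  set F : EuclideanSpace ℝ (Fin n) → ℝ≥0∞ :=
    fun x => ⨆ j, (E j).indicator (fun _ => ENNReal.ofReal (T j)) x with hF
  set G : EuclideanSpace ℝ (Fin n) → ℝ≥0∞ :=
    fun x => ∑' j, (E j).indicator (fun _ => ENNReal.ofReal (T j ^ (1 + l j))) x with hG
  have hFm : Measurable F := Measurable.iSup fun j => measurable_const.indicator (hEm j)
  have hGm : Measurable G := Measurable.tsum fun j => measurable_const.indicator (hEm j)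
  have hGi : ∫⁻ x in Ω, G x ≠ ∞ := by
    have hs : Summable fun j : ℕ => c * (1 / 2 : ℝ) ^ j := summable_geometric_two.mul_left c
    rw [hG, lintegral_tsum fun j => (measurable_const.indicator (hEm j)).aemeasurable]
    convert hs.tsum_ofReal_ne_top using 3 with j
    rw [lintegral_indicator_const (hEm j), hEr, hEv, ← ENNReal.ofReal_mul (hTl j).le]
    congr 1
    have := (hTl j).ne'
    field_simp
  have hFG : ∀ x, F x ≤ G x := by
    intro x
    refine iSup_le fun j => le_trans ?_ (ENNReal.le_tsum j)
    refine indicator_le_indicator (ENNReal.ofReal_le_ofReal ?_)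
    exact Real.self_le_rpow_of_one_le (hT j) (by linarith [hl j])
  have hFt : ∀ᵐ x ∂volume.restrict Ω, F x < ∞ := by
    filter_upwards [ae_lt_top hGm hGi] with x hx
    exact (hFG x).trans_lt hx
  set f : EuclideanSpace ℝ (Fin n) → ℝ := fun x => (F x).toReal with hf
  have hfmem : f ∈ variableLebesgue Ω p := by
    refine ⟨hFm.ennreal_toReal.aemeasurable, 1, one_pos, ?_⟩
    rw [varModular_eq_lintegral hΩ hbdd]
    refine lt_of_le_of_lt (lintegral_mono_ae ?_) hGi.lt_top
    filter_upwards [hpp, ae_ne_top_of_exponentSup_lt_top hbdd,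
      ae_restrict_mem hΩ.measurableSet] with x hx hxt hxΩ
    have hq : 1 ≤ (p x).toReal := by
      rw [← ENNReal.toReal_one]
      exact ENNReal.toReal_mono hxt (hp.one_le x hxΩ)
    set q := (p x).toReal with hqdef
    have hq0 : 0 < q := zero_lt_one.trans_le hq
    -- Each piece satisfies `T j ^ q ≤ G x` on `E j`, so `F x ≤ G x ^ (1 / q)`.
    have hFq : F x ^ q ≤ G x := by
      rw [← ENNReal.le_rpow_inv_iff hq0]
      refine iSup_le fun j => ?_
      rw [ENNReal.le_rpow_inv_iff hq0]
      refine le_trans ?_ (ENNReal.le_tsum j)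
      by_cases hxE : x ∈ E j
      · rw [indicator_of_mem hxE, indicator_of_mem hxE,
          ENNReal.ofReal_rpow_of_nonneg (hT0 j).le hq0.le]
        refine ENNReal.ofReal_le_ofReal (Real.rpow_le_rpow_of_exponent_le (hT j) ?_)
        have h1 : p x ≤ ENNReal.ofReal (1 + l j) := by
          rw [hx, ENNReal.ofReal_add zero_le_one (hl j).le, ENNReal.ofReal_one]
          exact (hEsub j hxE).2
        exact ENNReal.toReal_le_of_le_ofReal (by linarith [hl j]) h1
      · rw [indicator_of_notMem hxE, ENNReal.zero_rpow_of_pos hq0]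
        exact zero_le
    rw [div_one, hf, abs_of_nonneg ENNReal.toReal_nonneg,
      ← ENNReal.ofReal_rpow_of_nonneg ENNReal.toReal_nonneg hq0.le]
    exact (ENNReal.rpow_le_rpow ENNReal.ofReal_toReal_le hq0.le).trans hFq
  intro hcon
  obtain ⟨-, s, hs, hmod⟩ := hcon hfmem
  set L := max 1 s with hL
  have hL1 : 1 ≤ L := le_max_left _ _
  have hL0 : 0 < L := by linarith
  have hlow : ∀ j, ENNReal.ofReal (c * 2 ^ j / (L * L ^ α)) ≤
      orliczModular Ω (zygmundYoung α) s f := by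
    intro j
    have h1 : ∫⁻ x in Ω, (E j).indicator (fun _ => ENNReal.ofReal (zygmundYoung α (T j / L))) x ≤
        orliczModular Ω (zygmundYoung α) s f := by
      refine lintegral_mono_ae ?_
      filter_upwards [hFt] with x hx
      refine indicator_apply_le' (fun hxE => ?_) fun _ => zero_le
      refine ENNReal.ofReal_le_ofReal
        (zygmundYoung_mono hα.le (div_nonneg (hT0 j).le hL0.le) ?_)
      have h2 : T j ≤ f x := by
        rw [hf, ← ENNReal.ofReal_le_iff_le_toReal hx.ne]
        refine le_trans ?_ (le_iSup _ j)
        rw [indicator_of_mem hxE]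
      rw [abs_of_nonneg ENNReal.toReal_nonneg]
      exact div_le_div₀ ENNReal.toReal_nonneg h2 hs (le_max_right _ _)
    rw [lintegral_indicator_const (hEm j), hEr, hEv,
      ← ENNReal.ofReal_mul (zygmundYoung_nonneg α (div_nonneg (hT0 j).le hL0.le))] at h1
    refine le_trans (ENNReal.ofReal_le_ofReal ?_) h1
    have h3 := (hM j).trans (zygmundYoung_le_mul_div hα.le (hT0 j).le hL1)
    have hLL : 0 < L * L ^ α := by positivity
    have hTj := hTl j
    calc c * 2 ^ j / (L * L ^ α)
        = (4 ^ j * T j ^ (1 + l j)) / (L * L ^ α) * (c * (1 / 2) ^ j / T j ^ (1 + l j)) := by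
          have : (4 : ℝ) ^ j = 2 ^ j * 2 ^ j := by rw [← mul_pow]; norm_num
          rw [this, one_div, inv_pow]
          field_simp
      _ ≤ _ := by
          gcongr
          rw [div_le_iff₀' hLL]
          exact h3
  have hreal : ∀ j : ℕ, c * 2 ^ j / (L * L ^ α) ≤
      (orliczModular Ω (zygmundYoung α) s f).toReal := fun j =>
    (ENNReal.ofReal_le_iff_le_toReal hmod.ne).1 (hlow j)
  obtain ⟨j, hj⟩ := pow_unbounded_of_one_lt
    ((orliczModular Ω (zygmundYoung α) s f).toReal * (L * L ^ α) / c) one_lt_two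
  have h4 := hreal j
  rw [div_le_iff₀ (by positivity)] at h4
  rw [div_lt_iff₀ hc] at hj
  linarith

/-- The weight in the lower limit, at `l = 1 / k` and with `y = θ k`. -/
theorem liminf_weight_inv_natCast {α y : ℝ} (hy : 0 < y) {k : ℕ} (hk : 3 ≤ k) :
    y ^ (-1 / (k : ℝ)⁻¹) * (k : ℝ)⁻¹ ^ (-α / (k : ℝ)⁻¹) *
      Real.log (1 / (k : ℝ)⁻¹) ^ (α / (k : ℝ)⁻¹) = ((k * Real.log k) ^ α / y) ^ k := by
  obtain ⟨hl1, hlk, hk3⟩ := natCast_log_bounds hk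
  have hk0 : (0 : ℝ) < k := by linarith
  have hl0 : 0 < Real.log k := by linarith
  simp only [div_inv_eq_mul, one_mul]
  rw [Real.rpow_mul_natCast hy.le, Real.rpow_mul_natCast (by positivity),
    Real.rpow_mul_natCast hl0.le, ← mul_pow, ← mul_pow, Real.mul_rpow hk0.le hl0.le,
    Real.inv_rpow hk0.le, Real.rpow_neg hk0.le, Real.rpow_neg_one, inv_inv]
  congr 1
  field_simp

/-- At the level `T = ((k log k) ^ α / y) ^ k` with `y` small compared with `(k log k) ^ α`, one has
`log T ≥ (α / 2) k log k`, so `M T` exceeds `T ^ (1 + 1 / k)` by a factor proportional to `y`. -/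
theorem mul_rpow_le_zygmundYoung {α y : ℝ} (hα : 0 < α) (hy : 0 < y) {k : ℕ} (hk : 3 ≤ k)
    (hyw : y ≤ (k * Real.log k) ^ (α / 2)) :
    1 ≤ ((k * Real.log k) ^ α / y) ^ k ∧
    (α / 2) ^ α * y * (((k * Real.log k) ^ α / y) ^ k) ^ (1 + (k : ℝ)⁻¹) ≤
      zygmundYoung α (((k * Real.log k) ^ α / y) ^ k) := by
  obtain ⟨hl1, hlk, hk3⟩ := natCast_log_bounds hk
  set w := (k : ℝ) * Real.log k with hw
  have hw1 : 1 ≤ w := by nlinarith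
  have hw0 : 0 < w := by linarith
  have hyw' : y ≤ w ^ α :=
    hyw.trans (Real.rpow_le_rpow_of_exponent_le hw1 (by linarith))
  have hb1 : 1 ≤ w ^ α / y := (one_le_div hy).2 hyw'
  have hT1 : 1 ≤ (w ^ α / y) ^ k := one_le_pow₀ hb1
  refine ⟨hT1, ?_⟩
  set T := (w ^ α / y) ^ k with hT
  have hT0 : 0 < T := by linarith
  have hlogT : α / 2 * w ≤ Real.log (Real.exp 1 + T) := by
    have h1 : Real.log T ≤ Real.log (Real.exp 1 + T) :=
      Real.log_le_log hT0 (by linarith [Real.exp_pos 1])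
    refine le_trans ?_ h1
    rw [hT, Real.log_pow, Real.log_div (by positivity) hy.ne', Real.log_rpow hw0]
    have h2 : Real.log y ≤ α / 2 * Real.log w := by
      rw [← Real.log_rpow hw0]
      exact Real.log_le_log hy hyw
    have h3 : Real.log k ≤ Real.log w :=
      Real.log_le_log (by linarith) (by rw [hw]; nlinarith)
    have h4 : α / 2 * Real.log k ≤ α * Real.log w - Real.log y := by nlinarith
    calc α / 2 * w = k * (α / 2 * Real.log k) := by rw [hw]; ring
      _ ≤ _ := by gcongr
  have hroot : T ^ (k : ℝ)⁻¹ = w ^ α / y :=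
    Real.pow_rpow_inv_natCast (by positivity) (by lia)
  rw [Real.rpow_add hT0, Real.rpow_one, hroot]
  calc (α / 2) ^ α * y * (T * (w ^ α / y)) = T * (α / 2 * w) ^ α := by
        rw [Real.mul_rpow (by positivity) hw0.le]; field_simp
    _ ≤ zygmundYoung α T := by
        unfold zygmundYoung
        gcongr

theorem not_subset_of_liminf_pos {n : ℕ} (hn : 1 ≤ n) {Ω : Set (EuclideanSpace ℝ (Fin n))}
    (hΩ : IsOpen Ω) (hfin : volume Ω < ∞) {p : EuclideanSpace ℝ (Fin n) → ℝ≥0∞}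
    (hp : IsExponent Ω p) (hbdd : exponentSup Ω p < ∞) {α : ℝ} (hα : 0 < α) {θ : ℝ → ℝ}
    (hθ : Tendsto θ atTop atTop)
    (h : 0 < liminf (fun l : ℝ => volume {x ∈ Ω | p x ≤ 1 + ENNReal.ofReal l} *
      ENNReal.ofReal (θ (1 / l) ^ (-1 / l) * l ^ (-α / l) * Real.log (1 / l) ^ (α / l)))
      (𝓝[>] 0)) :
    ¬ variableLebesgue Ω p ⊆ zygmundSpace Ω α := by
  obtain ⟨c, hc0, hc⟩ := ENNReal.lt_iff_exists_nnreal_btwn.1 h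
  have hc0' : 0 < (c : ℝ) := by exact_mod_cast hc0
  have hev := (tendsto_inv_atTop_nhdsGT_zero.comp tendsto_natCast_atTop_atTop).eventually
    (eventually_lt_of_lt_liminf hc)
  have hθk : Tendsto (fun k : ℕ => θ k) atTop atTop := hθ.comp tendsto_natCast_atTop_atTop
  have hwk := (tendsto_rpow_atTop (half_pos hα)).comp tendsto_natCast_mul_log
  have hα2 : 0 < (α / 2) ^ α := by positivity
  refine not_subset_zygmundSpace_of_levels hn hΩ hfin hp hbdd hα hc0' fun j => ?_
  have hJ : 0 < 4 ^ j / (α / 2) ^ α := by positivity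
  obtain ⟨k, ⟨⟨hk1, hk2⟩, hk3⟩, hk⟩ := (((hev.and
    (hθk.eventually_ge_atTop (4 ^ j / (α / 2) ^ α))).and
    (hwk.eventually_ge_atTop (4 ^ j / (α / 2) ^ α))).and (eventually_ge_atTop 3)).exists
  -- Capping `θ` only lowers the growth required of the measure, and makes the level `T` large.
  set y := min (θ k) ((k * Real.log k) ^ (α / 2)) with hy
  have hyJ : 4 ^ j / (α / 2) ^ α ≤ y := le_min hk2 hk3
  have hy0 : 0 < y := hJ.trans_le hyJ
  obtain ⟨hT1, hTM⟩ := mul_rpow_le_zygmundYoung hα hy0 hk (min_le_right _ _)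
  obtain ⟨hl1, hlk, hk3'⟩ := natCast_log_bounds hk
  have hki : 0 < (k : ℝ)⁻¹ := by positivity
  refine ⟨(k : ℝ)⁻¹, ((k * Real.log k) ^ α / y) ^ k, hki, hT1, ?_, le_trans ?_ hTM⟩
  · simp only [Function.comp_apply] at hk1
    have hθ1 : θ (1 / (k : ℝ)⁻¹) = θ k := by rw [one_div, inv_inv]
    rw [hθ1, liminf_weight_inv_natCast (hJ.trans_le hk2) hk] at hk1
    rw [ENNReal.ofReal_coe_nnreal]
    refine hk1.le.trans ?_
    gcongr
    calc ((k * Real.log k) ^ α / θ k) ^ k ≤ ((k * Real.log k) ^ α / y) ^ k := by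
          have := hJ.trans_le hk2
          gcongr
          exact min_le_left _ _
      _ ≤ _ := Real.self_le_rpow_of_one_le hT1 (by linarith)
  · gcongr
    rwa [div_le_iff₀' hα2] at hyJ

theorem theorem1p1 (n : ℕ) (hn : 1 ≤ n) (Ω : Set (EuclideanSpace ℝ (Fin n)))
    (hΩ : IsOpen Ω) (hfin : volume Ω < ∞)
    (p : EuclideanSpace ℝ (Fin n) → ℝ≥0∞) (hp : IsExponent Ω p)
    (hbdd : exponentSup Ω p < ∞) (α : ℝ) (hα : 0 < α) :
    ((∃ C : ℝ, 1 < C ∧ ∀ᶠ l : ℝ in 𝓝[>] 0,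
        volume {x ∈ Ω | p x ≤ 1 + ENNReal.ofReal l} ≤
          ENNReal.ofReal (C ^ (1 / l) * l ^ (α / l) * Real.log (1 / l) ^ (-α / l))) →
      variableLebesgue Ω p ⊆ zygmundSpace Ω α ∧
        ∃ K : ℝ≥0, ∀ f ∈ variableLebesgue Ω p,
          orliczNorm Ω (zygmundYoung α) f ≤ K * varNorm Ω p f) ∧
    (∀ θ : ℝ → ℝ, (∀ t, 0 ≤ t → 0 ≤ θ t) → MonotoneOn θ (Ici 0) →
      DifferentiableOn ℝ θ (Ici 0) → Tendsto θ atTop atTop →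
      (∃ δ : ℝ, 0 < δ ∧
        MonotoneOn (fun l : ℝ => θ (1 / l) * (1 / l) ^ (-α) * Real.log (1 / l) ^ (-α))
          (Ioo 0 δ)) →
      0 < liminf (fun l : ℝ => volume {x ∈ Ω | p x ≤ 1 + ENNReal.ofReal l} *
          ENNReal.ofReal (θ (1 / l) ^ (-1 / l) * l ^ (-α / l) * Real.log (1 / l) ^ (α / l)))
        (𝓝[>] 0) →
      ¬ variableLebesgue Ω p ⊆ zygmundSpace Ω α) := by
  refine ⟨fun ⟨C, hC, h⟩ => ?_, fun θ _ _ _ hθ _ h => ?_⟩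
  · obtain ⟨a, b, hab⟩ := exists_modular_le_of_measure_le hΩ hfin hp hbdd hα hC h
    exact embedding_of_modular_le hα hab
  · exact not_subset_of_liminf_pos hn hΩ hfin hp hbdd hα hθ h
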